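/- Let $d\ge 0$ be an integer, let $\kappa_1>0$, let $(\chi_\ell)_{\ell\ge 0}$ be vectors in ${\bf C}^d$ with $\sum_{\ell=0}^\infty\|\chi_\ell\|<\infty$, and let $\sigma$ be a constant complex $d\times d$ matrix. Put $$\psi(t)=\sum_{\ell=0}^\infty e^{-(\kappa_1+\ell+1/2)t}\chi_\ell\qquad(\Re t\ge 0).$$ For a symbol $\varphi:\{\Re w\geq 0\}\to{\bf C}^d$ of this kind the tau function is the Fredholm determinant $\tau_\varphi(w)=\det(I-K_w)$ of the integral operator $K_w$ on $L^2(0,\infty)$ with kernel $$K_w(x,y)=\int_0^\infty\varphi(x+u+\bar w)^\dagger\,\sigma\,\varphi(u+y+w)\,du ,$$ so that $K_w=\Gamma^\dagger\sigma\Gamma$ with $\Gamma$ the Hankel operator with symbol $\varphi(\cdot+w)$ when $w\geq 0$. Let $\tau=\tau_\psi$. On $\ell^2$ consider, for $n\ge 0$, the truncations $A_n={\rm diagonal}[\kappa_1+\frac12,\kappa_1+\frac32,\dots,\kappa_1+n+\frac12,0,0,\dots]$, the column $B_n=(\|\chi_0\|^{1/2},\dots,\|\chi_n\|^{1/2},0,\dots)$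 and the row of column vectors $C_n=(\chi_0/\|\chi_0\|^{1/2},\dots,\chi_n/\|\chi_n\|^{1/2},0,\dots)$ (an entry with $\chi_\ell=0$ being $0$); let $\psi_n(t)=C_ne^{-tA_n}B_n$ and $\tau_n=\tau_{\psi_n}$. Theorem 10.2. The functions $t\mapsto\tau(2t)$ and $t\mapsto\tau_n(2t)$ are analytic and not identically zero on $\{t:\Re t>0\}$, and the following hold. (i) The matrices $A_n$ have finite rank; for every $n$ the meromorphic function $\frac{d}{dt}\log\tau_n(2t)$ on $\{\Re t>0\}$ belongs to the field ${\bf C}(e^{-(\kappa_1+1/2)t},e^{-t})$; and $\tau_n(2t)\to\tau(2t)$ as $n\to\infty$, uniformly on compact subsets of $\{t:\Re t>0\}$. (ii) Suppose further that $\kappa_1$ is rational. Then there exists a positive integer $N$ such that $\frac{d}{dt}\log\tau(2t)$ is periodic with period $2\pi iN$ on $\{\Re t>0\}$ and, for every $n$, there is a rational function $r_n$ with $\frac{d}{dt}\log\tau_n(2t)=r_n(e^{-t/N})$. If moreover $\sigma$ is Hermitian, then for every $n$ the function $\tau_n(2t)$ is real for $t>0$ and is given by elementary functions: there are a real polynomial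 $q_n$ and finitely many real numbers $\alpha_k,a_k$ and $\beta_j,\gamma_j,b_j,c_j$ with $b_j^2<c_j$ such that, for all $t>0$ with $\tau_n(2t)\neq 0$, one has $e^{-t/N}\ne a_k$ for all $k$ and $$\log|\tau_n(2t)|=q_n(e^{-t/N})+\sum_k\alpha_k\log|e^{-t/N}-a_k|+\sum_j\beta_j\log\bigl(e^{-2t/N}+2b_je^{-t/N}+c_j\bigr)+\sum_j\frac{\gamma_j}{\sqrt{c_j-b_j^2}}\tan^{-1}\frac{e^{-t/N}+b_j}{\sqrt{c_j-b_j^2}} .$$ -/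

import Mathlib

open MeasureTheory Filter Topology

noncomputable section

namespace TauSystem

/-- The Hilbert sequence space `ℓ²`. -/
abbrev EllTwo : Type := lp (fun _ : ℕ => ℂ) 2

/-- The standard orthonormal basis of `ℓ²`. -/
def basisVec (l : ℕ) : EllTwo := lp.single 2 l (1 : ℂ)

/-- The open right half-plane. -/
def rightHalfPlane : Set ℂ := {t : ℂ | 0 < t.re}

/-- The Fredholm determinant `det (I - K)` of the integral operator on `L²((0, ∞); dx)` with
kernel `K`, by Fredholm's series
`∑ₙ (-1)ⁿ / n! ∫_{(0,∞)ⁿ} det [K (xᵢ, xⱼ)] dx₁ ⋯ dxₙ`. -/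
def fredholmDet (K : ℝ → ℝ → ℂ) : ℂ :=
  ∑' n : ℕ, ((-1 : ℂ) ^ n / (n.factorial : ℂ)) *
    ∫ x in Set.univ.pi (fun _ : Fin n => Set.Ioi (0 : ℝ)),
      (Matrix.of fun i j : Fin n => K (x i) (x j)).det

/-- The kernel of `Γ† σ Γ`, where `Γ` is the Hankel operator on `L²(0, ∞)` with
symbol `x ↦ φ (x + w)`; the factor `Γ†` has the symbol `x ↦ φ (x + conj w)†`, so that the kernel
is analytic in `w` when `φ` is analytic:
`K_w (x, y) = ∫_0^∞ φ (x + u + conj w)† σ φ (u + y + w) du`. -/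
def hankelKernel {d : ℕ} (σ : Matrix (Fin d) (Fin d) ℂ) (φ : ℂ → EuclideanSpace ℂ (Fin d))
    (w : ℂ) (x y : ℝ) : ℂ :=
  ∫ u in Set.Ioi (0 : ℝ),
    inner ℂ (φ ((x : ℂ) + (u : ℂ) + (starRingEnd ℂ) w))
      (Matrix.toEuclideanLin σ (φ ((u : ℂ) + (y : ℂ) + w)))

/-- The tau function `τ (w) = det (I - Γ† σ Γ)`, where `Γ` is the Hankel operator with symbol
`x ↦ φ (x + w)`. For real `w = 2 s ≥ 0` this is `det (I - P_{(2 s, ∞)} K)` with `K` the operator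
at `w = 0`. -/
def tau {d : ℕ} (σ : Matrix (Fin d) (Fin d) ℂ) (φ : ℂ → EuclideanSpace ℂ (Fin d)) (w : ℂ) : ℂ :=
  fredholmDet (hankelKernel σ φ w)

/-- The symbol `φ (t) = C e^{-tA} B` that is realised by the linear system `(-A, B, C)` with
state space `ℓ²`, input space `ℂ` and output space `ℂ^d`. -/
def realisedSymbol {d : ℕ} (A : EllTwo →L[ℂ] EllTwo) (B : EllTwo)
    (C : EllTwo →L[ℂ] EuclideanSpace ℂ (Fin d)) (t : ℂ) : EuclideanSpace ℂ (Fin d) :=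
  C (NormedSpace.exp (-(t • A)) B)

/-- The symbol `ψ (t) = ∑_l e^{-(κ + l + 1/2) t} χ_l`. -/
def symbol {d : ℕ} (κ : ℝ) (χ : ℕ → EuclideanSpace ℂ (Fin d)) (t : ℂ) :
    EuclideanSpace ℂ (Fin d) :=
  ∑' l : ℕ, Complex.exp (-(((κ + l + 1 / 2 : ℝ) : ℂ) * t)) • χ l

/-- The matrix `A_n = diagonal [κ + 1/2, κ + 3/2, …, κ + n + 1/2, 0, 0, …]` on `ℓ²`. -/
def truncA (κ : ℝ) (n : ℕ) : EllTwo →L[ℂ] EllTwo :=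
  ∑ l ∈ Finset.range (n + 1),
    ((κ + l + 1 / 2 : ℝ) : ℂ) • (innerSL ℂ (basisVec l)).smulRight (basisVec l)

/-- The column `B_n = (‖χ_0‖^{1/2}, …, ‖χ_n‖^{1/2}, 0, 0, …)`. -/
def truncB {d : ℕ} (χ : ℕ → EuclideanSpace ℂ (Fin d)) (n : ℕ) : EllTwo :=
  ∑ l ∈ Finset.range (n + 1), ((Real.sqrt ‖χ l‖ : ℝ) : ℂ) • basisVec l

/-- The row of column vectors
`C_n = (χ_0 / ‖χ_0‖^{1/2}, …, χ_n / ‖χ_n‖^{1/2}, 0, 0, …)`; an entry with `χ_l = 0` is `0`. -/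
def truncC {d : ℕ} (χ : ℕ → EuclideanSpace ℂ (Fin d)) (n : ℕ) :
    EllTwo →L[ℂ] EuclideanSpace ℂ (Fin d) :=
  ∑ l ∈ Finset.range (n + 1),
    (innerSL ℂ (basisVec l)).smulRight (((Real.sqrt ‖χ l‖ : ℝ) : ℂ)⁻¹ • χ l)

/-- The tau function `τ_n` of the truncated linear system `(-A_n, B_n, C_n)`. -/
def tauTrunc {d : ℕ} (κ : ℝ) (χ : ℕ → EuclideanSpace ℂ (Fin d)) (σ : Matrix (Fin d) (Fin d) ℂ)
    (n : ℕ) (w : ℂ) : ℂ :=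
  tau σ (realisedSymbol (truncA κ n) (truncB χ n) (truncC χ n)) w

/-- `h` belongs to the field `ℂ(f, g)` of meromorphic functions on the right half-plane:
`h = P(f, g) / Q(f, g)` with `P, Q` polynomials such that `Q(f, g)` does not vanish identically.
(For analytic `f, g`, the excluded points, where `Q(f, g) = 0`, form a discrete set.) -/
def MemRationalField (f g h : ℂ → ℂ) : Prop :=
  ∃ P Q : MvPolynomial (Fin 2) ℂ,
    (∃ t ∈ rightHalfPlane, MvPolynomial.eval ![f t, g t] Q ≠ 0) ∧
    ∀ t ∈ rightHalfPlane, MvPolynomial.eval ![f t, g t] Q ≠ 0 →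
      h t = MvPolynomial.eval ![f t, g t] P / MvPolynomial.eval ![f t, g t] Q

/-- `F` is analytic and not identically zero on the right half-plane, so that
`d/dt log F = F' / F` is a meromorphic function there. -/
def AnalyticNonzero (F : ℂ → ℂ) : Prop :=
  DifferentiableOn ℂ F rightHalfPlane ∧ ∃ t ∈ rightHalfPlane, F t ≠ 0

/-- The elementary function
`q(z) + ∑ α_k log |z - a_k| + ∑ β_j log (z² + 2 b_j z + c_j)
  + ∑ γ_j / √(c_j - b_j²) · arctan ((z + b_j) / √(c_j - b_j²))` of a real variable. -/
def elementaryForm {m m' : ℕ} (q : Polynomial ℝ) (α a : Fin m → ℝ) (β γ b c : Fin m' → ℝ)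
    (z : ℝ) : ℝ :=
  q.eval z + (∑ k, α k * Real.log |z - a k|)
    + (∑ j, β j * Real.log (z ^ 2 + 2 * b j * z + c j))
    + ∑ j, γ j / Real.sqrt (c j - b j ^ 2) *
        Real.arctan ((z + b j) / Real.sqrt (c j - b j ^ 2))

end TauSystem

end

/-! The proof views τ in two ways, analytic and algebraic. Analytically, the kernel is bounded by `C
e^{-(κ+1/2)(x+y)}`, with `C` depending only on `σ` and `∑ ‖χ l‖`, hence uniformly over `Re w ≥ 0`
and over all truncations. Hadamard's inequality then dominates Fredholm's series by `∑ (√k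
C/(2κ+1))^k / k!`, so dominated convergence makes τ jointly continuous in the coefficients and in
`w` (`tendsto_tau`). Joint continuity gives τ_n → τ locally uniformly. The kernel vanishes as `w →
+∞`, so the determinant tends to 1 and is not identically zero. Algebraically, a truncated symbol is
a finite sum of exponentials, so its kernel has finite rank and Fredholm's series terminates
(`exists_fredholmDet_separableKernel`). Hence τ_n(2t) is a polynomial in `e^{-(κ+1/2)t}` and
`e^{-t}` (`exists_tauTrunc_eq_eval`). Such polynomials are closed under `d/dt`, which puts the
logarithmic derivative in the required field. Analyticity of τ follows from that of τ_n by
Weierstrass' theorem. If `κ + 1/2 = a/N`, then τ_n(2t) is a polynomial in `z = e^{-t/N}`, and the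
symbol has period `4πiN`, which is `2πiN` in `t` after doubling. If σ is Hermitian, the kernel is
Hermitian for real `w`, so that polynomial has real coefficients; the logarithm of its real
factorisation is the elementary formula. -/

/-! ### Hadamard bounds and the majorant of Fredholm's series -/

open scoped ComplexOrder in
/-- Hadamard's inequality in its weak form, by the inequality of arithmetic and geometric means
for the eigenvalues of `M * Mᴴ`. -/
theorem Matrix.norm_det_le_of_norm_le {k : ℕ} (M : Matrix (Fin k) (Fin k) ℂ) {C : ℝ}
    (hC : 0 ≤ C) (hM : ∀ i j, ‖M i j‖ ≤ C) : ‖M.det‖ ≤ (Real.sqrt k * C) ^ k := by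
  rcases Nat.eq_zero_or_pos k with rfl | hk
  · simp
  have hk' : (0 : ℝ) < k := by exact_mod_cast hk
  have hP : (M * M.conjTranspose).PosSemidef := Matrix.posSemidef_self_mul_conjTranspose M
  set ev := hP.isHermitian.eigenvalues
  have hev : ∀ i, 0 ≤ ev i := hP.eigenvalues_nonneg
  have hdet : ‖M.det‖ ^ 2 = ∏ i, ev i := by
    have h := hP.isHermitian.det_eq_prod_eigenvalues
    rw [Matrix.det_mul, Matrix.det_conjTranspose, RCLike.star_def, Complex.mul_conj] at h
    rw [← Complex.normSq_eq_norm_sq]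
    exact Complex.ofReal_injective (h.trans (Complex.ofReal_prod _ _).symm)
  have htr : ∑ i, ev i ≤ k * (k * C ^ 2) := by
    have h := hP.isHermitian.trace_eq_sum_eigenvalues
    have h2 : (M * M.conjTranspose).trace = ((∑ i, ∑ j, ‖M i j‖ ^ 2 : ℝ) : ℂ) := by
      simp [Matrix.trace, Matrix.mul_apply, Complex.mul_conj, Complex.normSq_eq_norm_sq]
    rw [h2] at h
    have h3 : (∑ i, ∑ j, ‖M i j‖ ^ 2 : ℝ) = ∑ i, ev i :=
      Complex.ofReal_injective (h.trans (Complex.ofReal_sum _ _).symm)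
    rw [← h3]
    calc (∑ i, ∑ j, ‖M i j‖ ^ 2 : ℝ) ≤ ∑ _i : Fin k, ∑ _j : Fin k, C ^ 2 := by
          gcongr with i _ j _
          exact hM i j
      _ = k * (k * C ^ 2) := by simp
  have hamgm : ∏ i, ev i ≤ (k * C ^ 2) ^ k := by
    have h := Real.geom_mean_le_arith_mean_weighted Finset.univ (fun _ : Fin k => (1 / k : ℝ)) ev
      (fun _ _ => by positivity) (by simp [hk'.ne']) (fun i _ => hev i)
    have h1 : ∏ i, ev i ^ (1 / k : ℝ) ≤ k * C ^ 2 := by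
      refine h.trans ?_
      rw [← Finset.mul_sum, one_div, inv_mul_le_iff₀ hk']
      exact htr
    have h2 : ∏ i, ev i = (∏ i, ev i ^ (1 / k : ℝ)) ^ k := by
      rw [← Finset.prod_pow]
      refine Finset.prod_congr rfl fun i _ => ?_
      rw [one_div, Real.rpow_inv_natCast_pow (hev i) hk.ne']
    rw [h2]
    exact pow_le_pow_left₀ (Finset.prod_nonneg fun i _ => Real.rpow_nonneg (hev i) _) h1 k
  refine le_of_sq_le_sq ?_ (by positivity)
  rw [hdet]
  refine hamgm.trans (le_of_eq ?_)
  rw [← pow_mul, mul_comm k 2, pow_mul, mul_pow (Real.sqrt k), Real.sq_sqrt hk'.le]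

/-- Scaling row `i` by `1/e i` and column `j` by `1/e j` reduces to entries bounded by `C`; each
weight comes out of the determinant twice. -/
theorem Matrix.norm_det_le_of_norm_le_mul {k : ℕ} (M : Matrix (Fin k) (Fin k) ℂ) {C : ℝ}
    (hC : 0 ≤ C) {e : Fin k → ℝ} (he : ∀ i, 0 < e i) (hM : ∀ i j, ‖M i j‖ ≤ C * (e i * e j)) :
    ‖M.det‖ ≤ (Real.sqrt k * C) ^ k * ∏ i, e i ^ 2 := by
  have hne : ∀ i, (e i : ℂ) ≠ 0 := fun i => by exact_mod_cast (he i).ne'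
  set L : Matrix (Fin k) (Fin k) ℂ := Matrix.of fun i j => M i j / (e i * e j) with hL
  have hML : M = Matrix.of fun i j => (e j : ℂ) * (Matrix.of fun i j => (e i : ℂ) * L i j) i j := by
    ext i j
    simp only [hL, Matrix.of_apply]
    field_simp [hne i, hne j]
  have hLb : ∀ i j, ‖L i j‖ ≤ C := fun i j => by
    simp only [hL, Matrix.of_apply, norm_div, norm_mul, Complex.norm_real, Real.norm_eq_abs,
      abs_of_pos (he i), abs_of_pos (he j)]
    rw [div_le_iff₀ (mul_pos (he i) (he j))]
    exact hM i j
  rw [hML, Matrix.det_mul_row, Matrix.det_mul_column, ← mul_assoc, ← Finset.prod_mul_distrib,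
    norm_mul, mul_comm]
  have h1 : ‖∏ i, ((e i : ℂ) * (e i : ℂ))‖ = ∏ i, e i ^ 2 := by
    rw [norm_prod]
    refine Finset.prod_congr rfl fun i _ => ?_
    rw [← sq, norm_pow, Complex.norm_real, Real.norm_eq_abs, abs_of_pos (he i)]
  rw [h1]
  exact mul_le_mul_of_nonneg_right (Matrix.norm_det_le_of_norm_le L hC hLb)
    (Finset.prod_nonneg fun i _ => sq_nonneg _)

/-- Since `k^k/k! ≤ e^k`, the square of the term is at most `(e A²)^k/k!`. The inequality `x ≤ 4^k
x² + 4^{-k}` then compares the term itself with an exponential series plus a geometric one. -/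
theorem summable_sqrt_mul_pow_div_factorial (A : ℝ) :
    Summable fun k : ℕ => (Real.sqrt k * A) ^ k / (k.factorial : ℝ) := by
  have h1 := Real.summable_pow_div_factorial (4 * Real.exp 1 * A ^ 2)
  have h2 : Summable fun k : ℕ => (1 / 4 : ℝ) ^ k :=
    summable_geometric_of_lt_one (by norm_num) (by norm_num)
  refine Summable.of_norm_bounded (h1.add h2) fun k => ?_
  set x := ‖(Real.sqrt k * A) ^ k / (k.factorial : ℝ)‖ with hx
  have hf : (0 : ℝ) < k.factorial := by positivity
  have hsq : x ^ 2 ≤ (Real.exp 1 * A ^ 2) ^ k / k.factorial := by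
    rw [hx, Real.norm_eq_abs, sq_abs, div_pow, ← pow_mul, mul_comm k 2, pow_mul, mul_pow,
      Real.sq_sqrt (Nat.cast_nonneg k), mul_pow, mul_pow, ← Real.exp_nat_mul, mul_one,
      sq (k.factorial : ℝ), ← div_div]
    have := Real.pow_div_factorial_le_exp (k : ℝ) (Nat.cast_nonneg k) k
    have hA : 0 ≤ (A ^ 2) ^ k := by positivity
    have h3 := mul_le_mul_of_nonneg_right this hA
    rw [div_mul_eq_mul_div] at h3
    gcongr
  have e1 : (4 * Real.exp 1 * A ^ 2) ^ k / (k.factorial : ℝ)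
      = 4 ^ k * ((Real.exp 1 * A ^ 2) ^ k / k.factorial) := by
    rw [mul_assoc, mul_pow]; ring
  have h4 : (0 : ℝ) < 4 ^ k := by positivity
  have e2 : (1 / 4 : ℝ) ^ k = 1 / 4 ^ k := by rw [one_div, inv_pow, one_div]
  rw [e1, e2]
  -- Completing the square gives `x ≤ 4^k x² + 4^{-k}`.
  have h5 : 4 ^ k * x ^ 2 + 1 / 4 ^ k - x = 4 ^ k * (x - 1 / (2 * 4 ^ k)) ^ 2 + 3 / (4 * 4 ^ k) := by
    field_simp
    ring
  have h6 : 0 ≤ (4 : ℝ) ^ k * (x - 1 / (2 * 4 ^ k)) ^ 2 + 3 / (4 * 4 ^ k) := by positivity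
  have h7 := mul_le_mul_of_nonneg_left hsq h4.le
  linarith

/-! ### Fredholm determinants under dominated convergence -/

namespace TauSystem

theorem integrableOn_prod_exp (μ : ℝ) (hμ : 0 < μ) (k : ℕ) :
    IntegrableOn (fun x : Fin k → ℝ => ∏ i, Real.exp (-μ * x i) ^ 2)
      (Set.univ.pi fun _ : Fin k => Set.Ioi (0 : ℝ)) := by
  rw [IntegrableOn, volume_pi, Measure.restrict_pi_pi]
  refine Integrable.fintype_prod (f := fun _ x => Real.exp (-μ * x) ^ 2) fun i => ?_
  have := exp_neg_integrableOn_Ioi 0 (b := 2 * μ) (by linarith)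
  refine this.congr (ae_of_all _ fun x => ?_)
  simp only [sq, ← Real.exp_add]
  congr 1; ring

theorem integral_prod_exp (μ : ℝ) (hμ : 0 < μ) (k : ℕ) :
    ∫ x in Set.univ.pi fun _ : Fin k => Set.Ioi (0 : ℝ), ∏ i, Real.exp (-μ * x i) ^ 2
      = (1 / (2 * μ)) ^ k := by
  rw [volume_pi, Measure.restrict_pi_pi,
    integral_fintype_prod_eq_prod (fun _ x => Real.exp (-μ * x) ^ 2)]
  have h : ∀ x, Real.exp (-μ * x) ^ 2 = Real.exp (-(2 * μ) * x) := fun x => by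
    simp only [sq, ← Real.exp_add]
    congr 1; ring
  simp only [h]
  rw [integral_exp_mul_Ioi (by linarith)]
  simp [neg_div]

theorem measurableSet_pi_Ioi (k : ℕ) :
    MeasurableSet (Set.univ.pi fun _ : Fin k => Set.Ioi (0 : ℝ)) :=
  MeasurableSet.univ_pi fun _ => measurableSet_Ioi

theorem aestronglyMeasurable_det {K : ℝ → ℝ → ℂ}
    (hK : ContinuousOn (Function.uncurry K) (Set.Ioi 0 ×ˢ Set.Ioi 0)) (k : ℕ) :
    AEStronglyMeasurable (fun x : Fin k → ℝ => (Matrix.of fun i j : Fin k => K (x i) (x j)).det)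
      (volume.restrict (Set.univ.pi fun _ : Fin k => Set.Ioi (0 : ℝ))) := by
  refine ContinuousOn.aestronglyMeasurable ?_ (measurableSet_pi_Ioi k)
  simp only [Matrix.det_apply]
  refine continuousOn_finsetSum _ fun s _ => ContinuousOn.const_smul ?_ _
  refine continuousOn_finsetProd _ fun i _ => ?_
  exact hK.comp (f := fun x : Fin k → ℝ => (x (s i), x i)) (by fun_prop)
    fun x hx => ⟨hx _ trivial, hx _ trivial⟩

/-- The Fredholm determinant is continuous under dominated pointwise convergence of kernels. -/
theorem tendsto_fredholmDet {ι : Type*} {F : Filter ι} [F.IsCountablyGenerated]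
    {K : ι → ℝ → ℝ → ℂ} {K₀ : ℝ → ℝ → ℂ} {C μ : ℝ} (hC : 0 ≤ C) (hμ : 0 < μ)
    (hcont : ∀ᶠ i in F, ContinuousOn (Function.uncurry (K i)) (Set.Ioi 0 ×ˢ Set.Ioi 0))
    (hbound : ∀ᶠ i in F, ∀ x > 0, ∀ y > 0, ‖K i x y‖ ≤ C * Real.exp (-μ * (x + y)))
    (hlim : ∀ x > 0, ∀ y > 0, Tendsto (fun i => K i x y) F (𝓝 (K₀ x y))) :
    Tendsto (fun i => fredholmDet (K i)) F (𝓝 (fredholmDet K₀)) := by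
  have hdet : ∀ᶠ i in F, ∀ k : ℕ, ∀ x ∈ Set.univ.pi fun _ : Fin k => Set.Ioi (0 : ℝ),
      ‖(Matrix.of fun a b : Fin k => K i (x a) (x b)).det‖
        ≤ (Real.sqrt k * C) ^ k * ∏ a, Real.exp (-μ * x a) ^ 2 := by
    filter_upwards [hbound] with i hi k x hx
    refine Matrix.norm_det_le_of_norm_le_mul _ hC (fun a => Real.exp_pos _) fun a b => ?_
    rw [← Real.exp_add, ← mul_add]
    exact hi _ (hx a trivial) _ (hx b trivial)
  -- Dominated convergence is used twice: for the series over `k`, and inside it for each `k`-fold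
  -- integral with the Hadamard majorant.
  refine tendsto_tsum_of_dominated_convergence
    (summable_sqrt_mul_pow_div_factorial (C * (1 / (2 * μ)))) (fun k => ?_) ?_
  · refine Tendsto.const_mul _ ?_
    refine tendsto_integral_filter_of_dominated_convergence
      (fun x => (Real.sqrt k * C) ^ k * ∏ a, Real.exp (-μ * x a) ^ 2) ?_ ?_
      ((integrableOn_prod_exp μ hμ k).const_mul _) ?_
    · filter_upwards [hcont] with i hi using aestronglyMeasurable_det hi k
    · filter_upwards [hdet] with i hi
      filter_upwards [ae_restrict_mem (measurableSet_pi_Ioi k)] with x hx using hi k x hx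
    · filter_upwards [ae_restrict_mem (measurableSet_pi_Ioi k)] with x hx
      simp only [Matrix.det_apply]
      refine tendsto_finsetSum _ fun s _ => Tendsto.const_smul ?_ _
      exact tendsto_finsetProd _ fun a _ => hlim _ (hx _ trivial) _ (hx _ trivial)
  · filter_upwards [hdet] with i hi k
    have h1 : ‖∫ x in Set.univ.pi fun _ : Fin k => Set.Ioi (0 : ℝ),
        (Matrix.of fun a b : Fin k => K i (x a) (x b)).det‖
          ≤ (Real.sqrt k * C) ^ k * (1 / (2 * μ)) ^ k := by
      rw [← integral_prod_exp μ hμ k, ← integral_const_mul]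
      refine norm_integral_le_of_norm_le ((integrableOn_prod_exp μ hμ k).const_mul _) ?_
      filter_upwards [ae_restrict_mem (measurableSet_pi_Ioi k)] with x hx using hi k x hx
    rw [norm_mul, norm_div, norm_pow, norm_neg, norm_one, one_pow, Complex.norm_natCast,
      ← mul_assoc, mul_pow _ (1 / (2 * μ)), one_div_mul_eq_div]
    gcongr

theorem fredholmDet_zero : fredholmDet (fun _ _ => 0) = 1 := by
  rw [fredholmDet, tsum_eq_single 0]
  · simp [volume_pi, Measure.real]
  · intro k hk
    have : NeZero k := ⟨hk⟩
    have h : (Matrix.of fun _ _ : Fin k => (0 : ℂ)).det = 0 :=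
      Matrix.det_eq_zero_of_row_eq_zero 0 fun _ => rfl
    simp [h]


/-! ### Bounds and joint continuity for the symbol, the kernel and τ -/

theorem norm_symbol_term_le (κ : ℝ) (χ : ℕ → EuclideanSpace ℂ (Fin d)) {t : ℂ} (ht : 0 ≤ t.re)
    (l : ℕ) : ‖Complex.exp (-(((κ + l + 1 / 2 : ℝ) : ℂ) * t)) • χ l‖
      ≤ Real.exp (-(κ + 1 / 2) * t.re) * ‖χ l‖ := by
  rw [norm_smul, Complex.norm_exp, Complex.neg_re, Complex.re_ofReal_mul]
  gcongr
  have : 0 ≤ (l : ℝ) * t.re := by positivity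
  linarith

theorem norm_symbol_le (κ : ℝ) {χ : ℕ → EuclideanSpace ℂ (Fin d)} {c : ℕ → ℝ} (hc : Summable c)
    (hχ : ∀ l, ‖χ l‖ ≤ c l) {t : ℂ} (ht : 0 ≤ t.re) :
    ‖symbol κ χ t‖ ≤ Real.exp (-(κ + 1 / 2) * t.re) * ∑' l, c l := by
  rw [← tsum_mul_left]
  exact tsum_of_norm_bounded (hc.mul_left _).hasSum fun l =>
    (norm_symbol_term_le κ χ ht l).trans (by gcongr; exact hχ l)

/-- Coefficients and argument vary along one filter under a common majorant `c`, so this covers both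
continuity in `t` and the passage from truncated to full symbols. -/
theorem tendsto_symbol {ι : Type*} {F : Filter ι} {κ : ℝ} (hκ : 0 < κ)
    {χ : ι → ℕ → EuclideanSpace ℂ (Fin d)} {χ₀ : ℕ → EuclideanSpace ℂ (Fin d)} {c : ℕ → ℝ}
    (hc : Summable c) (hχ : ∀ i l, ‖χ i l‖ ≤ c l)
    (hlim : ∀ l, Tendsto (fun i => χ i l) F (𝓝 (χ₀ l))) {t : ι → ℂ} {t₀ : ℂ}
    (ht : ∀ᶠ i in F, 0 ≤ (t i).re) (htlim : Tendsto t F (𝓝 t₀)) :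
    Tendsto (fun i => symbol κ (χ i) (t i)) F (𝓝 (symbol κ χ₀ t₀)) := by
  refine tendsto_tsum_of_dominated_convergence hc (fun l => ?_) ?_
  · exact Tendsto.smul ((Complex.continuous_exp.tendsto _).comp (htlim.const_mul _).neg) (hlim l)
  · filter_upwards [ht] with i hi l
    refine (norm_symbol_term_le κ (χ i) hi l).trans (le_trans ?_ (hχ i l))
    refine mul_le_of_le_one_left (norm_nonneg _) (Real.exp_le_one_iff.2 ?_)
    have : 0 ≤ (κ + 1 / 2) * (t i).re := by positivity
    linarith

theorem continuousOn_symbol {κ : ℝ} (hκ : 0 < κ) {χ : ℕ → EuclideanSpace ℂ (Fin d)}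
    (hχ : Summable fun l => ‖χ l‖) : ContinuousOn (symbol κ χ) {t : ℂ | 0 ≤ t.re} :=
  fun _ _ => tendsto_symbol hκ hχ (fun _ _ => le_rfl) (fun _ => tendsto_const_nhds)
    self_mem_nhdsWithin (tendsto_id.mono_left nhdsWithin_le_nhds)

theorem integrand_arg_re (x u : ℝ) (w : ℂ) :
    ((x : ℂ) + (u : ℂ) + (starRingEnd ℂ) w).re = x + u + w.re ∧
      ((x : ℂ) + (u : ℂ) + w).re = x + u + w.re := by simp

/-- The constant in the exponential bound for the kernel. -/
noncomputable def kernelConst (σ : Matrix (Fin d) (Fin d) ℂ) (c : ℕ → ℝ) : ℝ :=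
  ‖LinearMap.toContinuousLinearMap (Matrix.toEuclideanLin σ)‖ * (∑' l, c l) ^ 2

theorem kernelConst_nonneg (σ : Matrix (Fin d) (Fin d) ℂ) (c : ℕ → ℝ) :
    0 ≤ kernelConst σ c := by unfold kernelConst; positivity

/-- Both factors decay at rate `κ + 1/2`, in `x + u + Re w` and in `u + y + Re w`; the product of
the bounds separates the variable `u`. -/
theorem norm_integrand_le {κ : ℝ} (σ : Matrix (Fin d) (Fin d) ℂ)
    {χ : ℕ → EuclideanSpace ℂ (Fin d)} {c : ℕ → ℝ} (hc : Summable c) (hχ : ∀ l, ‖χ l‖ ≤ c l)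
    {w : ℂ} (hw : 0 ≤ w.re) {x y u : ℝ} (hx : 0 ≤ x) (hy : 0 ≤ y) (hu : 0 ≤ u) :
    ‖inner ℂ (symbol κ χ ((x : ℂ) + (u : ℂ) + (starRingEnd ℂ) w))
      (Matrix.toEuclideanLin σ (symbol κ χ ((u : ℂ) + (y : ℂ) + w)))‖
    ≤ kernelConst σ c * Real.exp (-(κ + 1 / 2) * (x + y + 2 * w.re))
        * Real.exp (-(2 * (κ + 1 / 2)) * u) := by
  set T := LinearMap.toContinuousLinearMap (Matrix.toEuclideanLin σ)
  have h1 := norm_symbol_le κ hc hχ (t := (x : ℂ) + (u : ℂ) + (starRingEnd ℂ) w)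
    (by rw [(integrand_arg_re x u w).1]; positivity)
  have h2 := norm_symbol_le κ hc hχ (t := (u : ℂ) + (y : ℂ) + w)
    (by rw [(integrand_arg_re u y w).2]; positivity)
  rw [(integrand_arg_re x u w).1] at h1
  rw [(integrand_arg_re u y w).2] at h2
  have h3 := T.le_opNorm (symbol κ χ ((u : ℂ) + (y : ℂ) + w))
  calc _ ≤ _ := norm_inner_le_norm _ _
    _ ≤ (Real.exp (-(κ + 1 / 2) * (x + u + w.re)) * ∑' l, c l)
        * (‖T‖ * (Real.exp (-(κ + 1 / 2) * (u + y + w.re)) * ∑' l, c l)) := by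
      refine mul_le_mul h1 (h3.trans ?_) (norm_nonneg _) ((norm_nonneg _).trans h1)
      gcongr
    _ = kernelConst σ c * (Real.exp (-(κ + 1 / 2) * (x + u + w.re))
          * Real.exp (-(κ + 1 / 2) * (u + y + w.re))) := by unfold kernelConst; ring
    _ = _ := by
      rw [mul_assoc (kernelConst σ c), ← Real.exp_add, ← Real.exp_add]
      congr 2; ring

theorem integrableOn_exp_bound {κ : ℝ} (hκ : 0 < κ) (M : ℝ) :
    IntegrableOn (fun u : ℝ => M * Real.exp (-(2 * (κ + 1 / 2)) * u)) (Set.Ioi 0) :=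
  (exp_neg_integrableOn_Ioi 0 (by positivity)).const_mul M

/-- The `u`-integral contributes `1/(2κ+1) ≤ 1`. The decay in `Re w` is kept because it drives the
limit at infinity. -/
theorem norm_hankelKernel_le {κ : ℝ} (hκ : 0 < κ) (σ : Matrix (Fin d) (Fin d) ℂ)
    {χ : ℕ → EuclideanSpace ℂ (Fin d)} {c : ℕ → ℝ} (hc : Summable c) (hχ : ∀ l, ‖χ l‖ ≤ c l)
    {w : ℂ} (hw : 0 ≤ w.re) {x y : ℝ} (hx : 0 ≤ x) (hy : 0 ≤ y) :
    ‖hankelKernel σ (symbol κ χ) w x y‖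
      ≤ kernelConst σ c * Real.exp (-(κ + 1 / 2) * (x + y + 2 * w.re)) := by
  have h : ‖hankelKernel σ (symbol κ χ) w x y‖ ≤ ∫ u in Set.Ioi (0 : ℝ),
      kernelConst σ c * Real.exp (-(κ + 1 / 2) * (x + y + 2 * w.re))
        * Real.exp (-(2 * (κ + 1 / 2)) * u) := by
    refine norm_integral_le_of_norm_le (integrableOn_exp_bound hκ _) ?_
    filter_upwards [ae_restrict_mem measurableSet_Ioi] with u hu
    exact norm_integrand_le σ hc hχ hw hx hy (le_of_lt hu)
  refine h.trans ?_
  rw [integral_const_mul, integral_exp_mul_Ioi (by linarith)]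
  refine mul_le_of_le_one_right (mul_nonneg (kernelConst_nonneg _ _) (Real.exp_pos _).le) ?_
  rw [mul_zero, Real.exp_zero, neg_div_neg_eq, div_le_one (by positivity)]
  linarith

theorem tendsto_hankelKernel {ι : Type*} {F : Filter ι} [F.IsCountablyGenerated] {κ : ℝ}
    (hκ : 0 < κ) (σ : Matrix (Fin d) (Fin d) ℂ)
    {χ : ι → ℕ → EuclideanSpace ℂ (Fin d)} {χ₀ : ℕ → EuclideanSpace ℂ (Fin d)} {c : ℕ → ℝ}
    (hc : Summable c) (hχ : ∀ i l, ‖χ i l‖ ≤ c l)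
    (hlim : ∀ l, Tendsto (fun i => χ i l) F (𝓝 (χ₀ l)))
    {w : ι → ℂ} {w₀ : ℂ} (hw : ∀ᶠ i in F, 0 ≤ (w i).re) (hwlim : Tendsto w F (𝓝 w₀))
    {x y : ι → ℝ} {x₀ y₀ : ℝ} (hx : ∀ᶠ i in F, 0 ≤ x i) (hy : ∀ᶠ i in F, 0 ≤ y i)
    (hxlim : Tendsto x F (𝓝 x₀)) (hylim : Tendsto y F (𝓝 y₀)) :
    Tendsto (fun i => hankelKernel σ (symbol κ (χ i)) (w i) (x i) (y i)) F
      (𝓝 (hankelKernel σ (symbol κ χ₀) w₀ x₀ y₀)) := by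
  have hT : Continuous (Matrix.toEuclideanLin σ) := LinearMap.continuous_of_finiteDimensional _
  refine tendsto_integral_filter_of_dominated_convergence
    (fun u => kernelConst σ c * Real.exp (-(2 * (κ + 1 / 2)) * u)) ?_ ?_
    (integrableOn_exp_bound hκ _) ?_
  · filter_upwards [hw, hx, hy] with i hwi hxi hyi
    have hs := continuousOn_symbol hκ (hc.of_norm_bounded (f := fun l => ‖χ i l‖)
      fun l => by simpa using hχ i l)
    refine ContinuousOn.aestronglyMeasurable (ContinuousOn.inner (𝕜 := ℂ) ?_
      (hT.comp_continuousOn ?_)) measurableSet_Ioi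
    · refine hs.comp (by fun_prop) fun u (hu : 0 < u) => ?_
      rw [Set.mem_ofPred_eq, (integrand_arg_re _ _ _).1]; positivity
    · refine hs.comp (by fun_prop) fun u (hu : 0 < u) => ?_
      rw [Set.mem_ofPred_eq, (integrand_arg_re _ _ _).2]; positivity
  · filter_upwards [hw, hx, hy] with i hwi hxi hyi
    filter_upwards [ae_restrict_mem measurableSet_Ioi] with u hu
    refine (norm_integrand_le σ hc (hχ i) hwi hxi hyi (le_of_lt hu)).trans ?_
    gcongr
    refine mul_le_of_le_one_right (kernelConst_nonneg _ _) (Real.exp_le_one_iff.2 ?_)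
    have : 0 ≤ (κ + 1 / 2) * (x i + y i + 2 * (w i).re) := by positivity
    linarith
  · filter_upwards [ae_restrict_mem measurableSet_Ioi] with u hu
    have hu' : 0 ≤ u := le_of_lt hu
    have hxl : Tendsto (fun i => (x i : ℂ)) F (𝓝 x₀) :=
      (Complex.continuous_ofReal.tendsto _).comp hxlim
    have hyl : Tendsto (fun i => (y i : ℂ)) F (𝓝 y₀) :=
      (Complex.continuous_ofReal.tendsto _).comp hylim
    refine Tendsto.inner ?_ ((hT.tendsto _).comp ?_)
    · refine tendsto_symbol hκ hc hχ hlim ?_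
        ((hxl.add_const _).add ((Complex.continuous_conj.tendsto _).comp hwlim))
      filter_upwards [hw, hx] with i hwi hxi
      rw [(integrand_arg_re _ _ _).1]; positivity
    · refine tendsto_symbol hκ hc hχ hlim ?_ ((hyl.const_add _).add hwlim)
      filter_upwards [hw, hy] with i hwi hyi
      rw [(integrand_arg_re _ _ _).2]; positivity

theorem continuousOn_hankelKernel {κ : ℝ} (hκ : 0 < κ) (σ : Matrix (Fin d) (Fin d) ℂ)
    {χ : ℕ → EuclideanSpace ℂ (Fin d)} {c : ℕ → ℝ} (hc : Summable c) (hχ : ∀ l, ‖χ l‖ ≤ c l)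
    {w : ℂ} (hw : 0 ≤ w.re) :
    ContinuousOn (Function.uncurry (hankelKernel σ (symbol κ χ) w))
      (Set.Ioi 0 ×ˢ Set.Ioi 0) := by
  rintro ⟨x, y⟩ _
  refine tendsto_hankelKernel hκ σ hc (fun _ => hχ) (fun _ => tendsto_const_nhds)
    (Eventually.of_forall fun _ => hw) tendsto_const_nhds ?_ ?_
    (continuous_fst.continuousWithinAt) (continuous_snd.continuousWithinAt)
  · filter_upwards [self_mem_nhdsWithin] with p hp using le_of_lt hp.1
  · filter_upwards [self_mem_nhdsWithin] with p hp using le_of_lt hp.2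

theorem norm_hankelKernel_le_exp {κ : ℝ} (hκ : 0 < κ) (σ : Matrix (Fin d) (Fin d) ℂ)
    {χ : ℕ → EuclideanSpace ℂ (Fin d)} {c : ℕ → ℝ} (hc : Summable c) (hχ : ∀ l, ‖χ l‖ ≤ c l)
    {w : ℂ} (hw : 0 ≤ w.re) {x y : ℝ} (hx : 0 ≤ x) (hy : 0 ≤ y) :
    ‖hankelKernel σ (symbol κ χ) w x y‖
      ≤ kernelConst σ c * Real.exp (-(κ + 1 / 2) * (x + y)) := by
  refine (norm_hankelKernel_le hκ σ hc hχ hw hx hy).trans ?_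
  have := kernelConst_nonneg σ c
  have h2 : 0 ≤ (κ + 1 / 2) * w.re := by positivity
  refine mul_le_mul_of_nonneg_left (Real.exp_le_exp.2 ?_) this
  linarith

theorem tendsto_tau {ι : Type*} {F : Filter ι} [F.IsCountablyGenerated] {κ : ℝ}
    (hκ : 0 < κ) (σ : Matrix (Fin d) (Fin d) ℂ)
    {χ : ι → ℕ → EuclideanSpace ℂ (Fin d)} {χ₀ : ℕ → EuclideanSpace ℂ (Fin d)} {c : ℕ → ℝ}
    (hc : Summable c) (hχ : ∀ i l, ‖χ i l‖ ≤ c l)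
    (hlim : ∀ l, Tendsto (fun i => χ i l) F (𝓝 (χ₀ l)))
    {w : ι → ℂ} {w₀ : ℂ} (hw : ∀ᶠ i in F, 0 ≤ (w i).re) (hwlim : Tendsto w F (𝓝 w₀)) :
    Tendsto (fun i => tau σ (symbol κ (χ i)) (w i)) F (𝓝 (tau σ (symbol κ χ₀) w₀)) := by
  refine tendsto_fredholmDet (kernelConst_nonneg σ c) (μ := κ + 1 / 2) (by positivity) ?_ ?_ ?_
  · filter_upwards [hw] with i hi using continuousOn_hankelKernel hκ σ hc (hχ i) hi
  · filter_upwards [hw] with i hi x hx y hy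
    exact norm_hankelKernel_le_exp hκ σ hc (hχ i) hi hx.le hy.le
  · intro x hx y hy
    exact tendsto_hankelKernel hκ σ hc hχ hlim hw hwlim (Eventually.of_forall fun _ => hx.le)
      (Eventually.of_forall fun _ => hy.le) tendsto_const_nhds tendsto_const_nhds

/-- The factor `e^{-2(κ+1/2)s}` sends the kernel to zero pointwise, under a majorant independent of
`s`, and `det (I - 0) = 1`. -/
theorem tendsto_tau_atTop {κ : ℝ} (hκ : 0 < κ) (σ : Matrix (Fin d) (Fin d) ℂ)
    {χ : ℕ → EuclideanSpace ℂ (Fin d)} (hχ : Summable fun l => ‖χ l‖) :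
    Tendsto (fun s : ℝ => tau σ (symbol κ χ) s) atTop (𝓝 1) := by
  rw [← fredholmDet_zero]
  have hpos : ∀ᶠ s : ℝ in atTop, 0 ≤ ((s : ℂ)).re := by
    filter_upwards [eventually_ge_atTop 0] with s hs using by simpa using hs
  refine tendsto_fredholmDet (kernelConst_nonneg σ fun l => ‖χ l‖) (μ := κ + 1 / 2)
    (by positivity) ?_ ?_ ?_
  · filter_upwards [hpos] with s hs
    exact continuousOn_hankelKernel hκ σ hχ (fun _ => le_rfl) hs
  · filter_upwards [hpos] with s hs x hx y hy
    exact norm_hankelKernel_le_exp hκ σ hχ (fun _ => le_rfl) hs hx.le hy.le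
  · intro x hx y hy
    refine squeeze_zero_norm' (a := fun s : ℝ => kernelConst σ (fun l => ‖χ l‖)
      * Real.exp (-(κ + 1 / 2) * (x + y + 2 * s))) ?_ ?_
    · filter_upwards [hpos] with s hs
      simpa using norm_hankelKernel_le hκ σ hχ (fun _ => le_rfl) hs hx.le hy.le
    · rw [← mul_zero (kernelConst σ fun l => ‖χ l‖)]
      refine Tendsto.const_mul _ (Real.tendsto_exp_atBot.comp ?_)
      refine Tendsto.const_mul_atTop_of_neg (by linarith) ?_
      exact tendsto_atTop_add_const_left _ _ (tendsto_id.const_mul_atTop (by norm_num))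

theorem exists_tau_ne_zero {κ : ℝ} (hκ : 0 < κ) (σ : Matrix (Fin d) (Fin d) ℂ)
    {χ : ℕ → EuclideanSpace ℂ (Fin d)} (hχ : Summable fun l => ‖χ l‖) :
    ∃ s : ℝ, 0 < s ∧ tau σ (symbol κ χ) (2 * (s : ℂ)) ≠ 0 := by
  have h := (tendsto_tau_atTop hκ σ hχ).eventually_ne one_ne_zero
  obtain ⟨s, hs, hs0⟩ := (h.and (eventually_gt_atTop 0)).exists
  exact ⟨s / 2, by positivity, by convert hs using 2; push_cast; ring⟩

end TauSystem

/-! ### Truncated linear systems and their separable kernels -/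

/-- An eigenvector of a bounded operator is an eigenvector of its exponential. -/
theorem ContinuousLinearMap.exp_apply_of_apply_eq_smul {E : Type*} [NormedAddCommGroup E]
    [NormedSpace ℂ E] [CompleteSpace E] {T : E →L[ℂ] E} {v : E} {z : ℂ} (h : T v = z • v) :
    NormedSpace.exp T v = Complex.exp z • v := by
  have h1 := (NormedSpace.exp_series_hasSum_exp' (𝕂 := ℂ) T).mapL
    (ContinuousLinearMap.apply ℂ E v)
  have h2 := (NormedSpace.exp_series_hasSum_exp' (𝕂 := ℂ) z).smul_const v
  rw [← Complex.exp_eq_exp_ℂ] at h2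
  refine h1.unique (h2.congr_fun fun n => ?_)
  have hn : (T ^ n) v = z ^ n • v := by
    induction n with
    | zero => simp
    | succ n ih => rw [pow_succ', mul_apply_eq_comp, ih, map_smul, h, smul_smul, pow_succ]
  simp [hn, smul_smul]

namespace TauSystem

variable {d : ℕ}

/-- The sequence `χ₀, …, χₙ, 0, 0, …`. -/
def cutoff (χ : ℕ → EuclideanSpace ℂ (Fin d)) (n l : ℕ) : EuclideanSpace ℂ (Fin d) :=
  if l ∈ Finset.range (n + 1) then χ l else 0

theorem norm_cutoff_le (χ : ℕ → EuclideanSpace ℂ (Fin d)) (n l : ℕ) : ‖cutoff χ n l‖ ≤ ‖χ l‖ := by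
  unfold cutoff
  split_ifs <;> simp

theorem summable_norm_cutoff {χ : ℕ → EuclideanSpace ℂ (Fin d)} (hχ : Summable fun l => ‖χ l‖)
    (n : ℕ) : Summable fun l => ‖cutoff χ n l‖ :=
  hχ.of_nonneg_of_le (fun _ => norm_nonneg _) (norm_cutoff_le χ n)

theorem tendsto_cutoff (χ : ℕ → EuclideanSpace ℂ (Fin d)) (l : ℕ) :
    Tendsto (fun n => cutoff χ n l) atTop (𝓝 (χ l)) := by
  refine tendsto_const_nhds.congr' ?_
  filter_upwards [eventually_ge_atTop l] with n hn
  rw [cutoff, if_pos (Finset.mem_range.2 (by omega))]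

theorem symbol_cutoff (κ : ℝ) (χ : ℕ → EuclideanSpace ℂ (Fin d)) (n : ℕ) (t : ℂ) :
    symbol κ (cutoff χ n) t = ∑ l ∈ Finset.range (n + 1),
      Complex.exp (-(((κ + l + 1 / 2 : ℝ) : ℂ) * t)) • χ l := by
  rw [symbol, tsum_eq_sum (s := Finset.range (n + 1))]
  · exact Finset.sum_congr rfl fun l hl => by rw [cutoff, if_pos hl]
  · intro l hl
    rw [cutoff, if_neg hl, smul_zero]

theorem inner_basisVec (l m : ℕ) :
    inner ℂ (basisVec l) (basisVec m) = if l = m then (1 : ℂ) else 0 := by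
  rw [basisVec, lp.inner_single_left, basisVec, lp.single_apply]
  by_cases h : l = m
  · subst h; simp
  · simp [h]

theorem truncA_basisVec (κ : ℝ) {n l : ℕ} (hl : l ∈ Finset.range (n + 1)) :
    truncA κ n (basisVec l) = ((κ + l + 1 / 2 : ℝ) : ℂ) • basisVec l := by
  simp only [truncA, _root_.sum_apply, _root_.smul_apply,
    ContinuousLinearMap.smulRight_apply, innerSL_apply_apply, inner_basisVec]
  rw [Finset.sum_eq_single l (fun m _ hm => by simp [hm]) fun h => absurd hl h]
  simp

theorem truncC_basisVec (χ : ℕ → EuclideanSpace ℂ (Fin d)) {n l : ℕ}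
    (hl : l ∈ Finset.range (n + 1)) :
    truncC χ n (basisVec l) = ((Real.sqrt ‖χ l‖ : ℝ) : ℂ)⁻¹ • χ l := by
  simp only [truncC, _root_.sum_apply,
    ContinuousLinearMap.smulRight_apply, innerSL_apply_apply, inner_basisVec]
  rw [Finset.sum_eq_single l (fun m _ hm => by simp [hm]) fun h => absurd hl h]
  simp

theorem finiteDimensional_range_truncA (κ : ℝ) (n : ℕ) :
    FiniteDimensional ℂ (truncA κ n).range := by
  let W := Submodule.span ℂ (basisVec '' (Finset.range (n + 1) : Set ℕ))
  have : FiniteDimensional ℂ W :=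
    FiniteDimensional.span_of_finite ℂ ((Finset.finite_toSet _).image _)
  refine Submodule.finiteDimensional_of_le (S₂ := W) ?_
  rintro _ ⟨v, rfl⟩
  change truncA κ n v ∈ W
  simp only [truncA, _root_.sum_apply, _root_.smul_apply,
    ContinuousLinearMap.smulRight_apply]
  exact W.sum_mem fun l hl => W.smul_mem _ (W.smul_mem _ (Submodule.subset_span ⟨l, hl, rfl⟩))

/-- The truncated linear system realises the truncated symbol. -/
theorem realisedSymbol_trunc (κ : ℝ) (χ : ℕ → EuclideanSpace ℂ (Fin d)) (n : ℕ) :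
    realisedSymbol (truncA κ n) (truncB χ n) (truncC χ n) = symbol κ (cutoff χ n) := by
  funext t
  rw [realisedSymbol, symbol_cutoff, truncB, map_sum, map_sum]
  refine Finset.sum_congr rfl fun l hl => ?_
  have h : (-(t • truncA κ n)) (basisVec l)
      = (-(((κ + l + 1 / 2 : ℝ) : ℂ) * t)) • basisVec l := by
    rw [_root_.neg_apply, _root_.smul_apply, truncA_basisVec κ hl,
      smul_smul, neg_smul, mul_comm]
  rw [map_smul, map_smul, ContinuousLinearMap.exp_apply_of_apply_eq_smul h, map_smul,
    truncC_basisVec χ hl, smul_comm, smul_smul (Complex.ofReal _)]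
  -- If `χ l = 0` then both sides vanish; otherwise the square roots coming from `B_n` and `C_n`
  -- cancel.
  by_cases h0 : χ l = 0
  · simp [h0]
  · rw [mul_inv_cancel₀, one_smul]
    simpa [Real.sqrt_eq_zero'] using h0

theorem tauTrunc_eq_tau_cutoff (κ : ℝ) (χ : ℕ → EuclideanSpace ℂ (Fin d))
    (σ : Matrix (Fin d) (Fin d) ℂ) (n : ℕ) :
    tauTrunc κ χ σ n = tau σ (symbol κ (cutoff χ n)) := by
  funext w
  rw [tauTrunc, realisedSymbol_trunc]

/-- The kernel of a truncated system is separable. -/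
theorem hankelKernel_cutoff {κ : ℝ} (hκ : 0 < κ) (σ : Matrix (Fin d) (Fin d) ℂ)
    (χ : ℕ → EuclideanSpace ℂ (Fin d)) (n : ℕ) (w : ℂ) (x y : ℝ) :
    hankelKernel σ (symbol κ (cutoff χ n)) w x y
      = ∑ l : Fin (n + 1), ∑ m : Fin (n + 1),
        Complex.exp (-((κ + l + 1 / 2 : ℝ) : ℂ) * x)
          * (inner ℂ (χ l) (Matrix.toEuclideanLin σ (χ m))
              / (((κ + l + 1 / 2 : ℝ) : ℂ) + ((κ + m + 1 / 2 : ℝ) : ℂ))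
              * Complex.exp (-(((κ + l + 1 / 2 : ℝ) : ℂ) + ((κ + m + 1 / 2 : ℝ) : ℂ)) * w))
          * Complex.exp (-((κ + m + 1 / 2 : ℝ) : ℂ) * y) := by
  have hint : ∀ l m : Fin (n + 1),
      (-(((κ + l + 1 / 2 : ℝ) : ℂ) + ((κ + m + 1 / 2 : ℝ) : ℂ))).re < 0 := fun l m => by
    rw [Complex.neg_re, Complex.add_re, Complex.ofReal_re, Complex.ofReal_re, neg_lt_zero]
    positivity
  have h : ∀ u : ℝ, inner ℂ (symbol κ (cutoff χ n) ((x : ℂ) + (u : ℂ) + (starRingEnd ℂ) w))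
      (Matrix.toEuclideanLin σ (symbol κ (cutoff χ n) ((u : ℂ) + (y : ℂ) + w)))
      = ∑ l : Fin (n + 1), ∑ m : Fin (n + 1),
        (Complex.exp (-((κ + l + 1 / 2 : ℝ) : ℂ) * x)
          * (inner ℂ (χ l) (Matrix.toEuclideanLin σ (χ m))
              * Complex.exp (-(((κ + l + 1 / 2 : ℝ) : ℂ) + ((κ + m + 1 / 2 : ℝ) : ℂ)) * w))
          * Complex.exp (-((κ + m + 1 / 2 : ℝ) : ℂ) * y))
        * Complex.exp (-(((κ + l + 1 / 2 : ℝ) : ℂ) + ((κ + m + 1 / 2 : ℝ) : ℂ)) * u) := fun u => by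
    rw [symbol_cutoff, symbol_cutoff, map_sum, sum_inner, Finset.sum_range]
    refine Finset.sum_congr rfl fun l _ => ?_
    rw [inner_sum, Finset.sum_range]
    refine Finset.sum_congr rfl fun m _ => ?_
    rw [inner_smul_left, map_smul, inner_smul_right, ← Complex.exp_conj]
    have e₂ : ∀ a b I : ℂ, Complex.exp a * (Complex.exp b * I) = I * Complex.exp (a + b) :=
      fun a b I => by rw [Complex.exp_add]; ring
    have e₄ : ∀ a b c d I : ℂ, Complex.exp a * (I * Complex.exp b) * Complex.exp c
        * Complex.exp d = I * Complex.exp (a + b + c + d) := fun a b c d I => by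
      rw [Complex.exp_add, Complex.exp_add, Complex.exp_add]; ring
    rw [e₂, e₄]
    congr 2
    -- The inner product conjugates its first argument, which turns `conj w` back into `w`, so the
    -- exponent is holomorphic in `w`.
    simp only [map_neg, map_mul, map_add, Complex.conj_ofReal, Complex.conj_conj]
    ring
  unfold hankelKernel
  simp only [h]
  have hI : ∀ l m : Fin (n + 1), ∀ c : ℂ, IntegrableOn (fun u : ℝ => c *
      Complex.exp (-(((κ + l + 1 / 2 : ℝ) : ℂ) + ((κ + m + 1 / 2 : ℝ) : ℂ)) * u)) (Set.Ioi 0) :=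
    fun l m c => (integrableOn_exp_mul_complex_Ioi (hint l m) 0).const_mul c
  rw [integral_finsetSum _ fun l _ => integrable_finsetSum _ fun m _ => hI l m _]
  refine Finset.sum_congr rfl fun l _ => ?_
  rw [integral_finsetSum _ fun m _ => hI l m _]
  refine Finset.sum_congr rfl fun m _ => ?_
  rw [integral_const_mul, integral_exp_mul_complex_Ioi (hint l m), Complex.ofReal_zero, mul_zero,
    Complex.exp_zero, neg_div_neg_eq]
  ring

end TauSystem

/-! ### Fredholm determinants of finite-rank kernels -/

namespace TauSystem

section Separable

variable {N : ℕ} (E : Fin N → ℝ → ℂ)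

/-- The separable kernel `∑ E_l(x) M_{lm} E_m(y)`. -/
def separableKernel (M : Fin N × Fin N → ℂ) (x y : ℝ) : ℂ :=
  ∑ l, ∑ m, E l x * M (l, m) * E m y

/-- The matrix factors through an `N`-dimensional space, so its rank is at most `N < k`. -/
theorem det_separableKernel_eq_zero (M : Fin N × Fin N → ℂ) {k : ℕ} (hk : N < k) (x : Fin k → ℝ) :
    (Matrix.of fun i j : Fin k => separableKernel E M (x i) (x j)).det = 0 := by
  have h : (Matrix.of fun i j : Fin k => separableKernel E M (x i) (x j))
      = (Matrix.of fun (i : Fin k) (l : Fin N) => E l (x i))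
        * (Matrix.of fun (l : Fin N) (j : Fin k) => ∑ m, M (l, m) * E m (x j)) := by
    ext i j
    simp [separableKernel, Matrix.mul_apply, Finset.mul_sum, mul_assoc]
  by_contra hne
  have h1 := Matrix.rank_of_isUnit _ ((Matrix.isUnit_iff_isUnit_det _).2 (isUnit_iff_ne_zero.2 hne))
  rw [h, Fintype.card_fin] at h1
  have h2 := (Matrix.rank_mul_le_left (Matrix.of fun (i : Fin k) (l : Fin N) => E l (x i))
    (Matrix.of fun (l : Fin N) (j : Fin k) => ∑ m, M (l, m) * E m (x j))).trans
    (Matrix.rank_le_width _)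
  omega

/-- The Leibniz expansion is arranged so that each variable `x i` occurs in a single factor; the
`k`-fold integrals of the terms are then integrals of products of one-variable functions. -/
theorem det_separableKernel (M : Fin N × Fin N → ℂ) {k : ℕ} (x : Fin k → ℝ) :
    (Matrix.of fun i j : Fin k => separableKernel E M (x i) (x j)).det
      = ∑ s : Equiv.Perm (Fin k), ∑ p : Fin k → Fin N × Fin N,
          ((Equiv.Perm.sign s : ℤ) : ℂ) * (∏ i, M (p i))
            * ∏ i, E (p (s⁻¹ i)).1 (x i) * E (p i).2 (x i) := by
  rw [Matrix.det_apply']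
  refine Finset.sum_congr rfl fun s _ => ?_
  have h : ∀ i, (Matrix.of fun i j : Fin k => separableKernel E M (x i) (x j)) (s i) i
      = ∑ p : Fin N × Fin N, E p.1 (x (s i)) * M p * E p.2 (x i) := fun i => by
    rw [Matrix.of_apply, separableKernel, Fintype.sum_prod_type]
  simp only [h]
  rw [Fintype.prod_sum, Finset.mul_sum]
  refine Finset.sum_congr rfl fun p _ => ?_
  -- Reindexing by `s` collects the left factor at `x (s i)` with the right factor at the same
  -- variable.
  have h2 : ∏ i, E (p i).1 (x (s i)) = ∏ i, E (p (s⁻¹ i)).1 (x i) := by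
    rw [← Equiv.prod_comp s fun i => E (p (s⁻¹ i)).1 (x i)]
    simp
  rw [Finset.prod_mul_distrib, Finset.prod_mul_distrib, Finset.prod_mul_distrib, h2]
  ring

/-- The Fredholm determinant of a separable kernel is a polynomial in the coefficients. -/
theorem exists_fredholmDet_separableKernel
    (hE : ∀ l m, IntegrableOn (fun x => E l x * E m x) (Set.Ioi 0)) :
    ∃ P : MvPolynomial (Fin N × Fin N) ℂ, ∀ M : Fin N × Fin N → ℂ,
      fredholmDet (separableKernel E M) = MvPolynomial.eval M P := by
  let I : (k : ℕ) → Equiv.Perm (Fin k) → (Fin k → Fin N × Fin N) → ℂ := fun k s p =>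
    ∫ x in Set.univ.pi fun _ : Fin k => Set.Ioi (0 : ℝ),
      ∏ i, E (p (s⁻¹ i)).1 (x i) * E (p i).2 (x i)
  refine ⟨∑ k ∈ Finset.range (N + 1), MvPolynomial.C ((-1 : ℂ) ^ k / (k.factorial : ℂ))
    * ∑ s : Equiv.Perm (Fin k), ∑ p : Fin k → Fin N × Fin N,
      MvPolynomial.C (((Equiv.Perm.sign s : ℤ) : ℂ) * I k s p)
        * ∏ i, MvPolynomial.X (p i), fun M => ?_⟩
  -- The rank bound kills every term with `k > N`, so the series stops at `k = N`.
  rw [fredholmDet, tsum_eq_sum (s := Finset.range (N + 1))]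
  · simp only [map_sum, map_mul, MvPolynomial.eval_C, map_prod, MvPolynomial.eval_X]
    refine Finset.sum_congr rfl fun k _ => ?_
    congr 1
    simp only [det_separableKernel]
    have hint : ∀ (s : Equiv.Perm (Fin k)) (p : Fin k → Fin N × Fin N),
        IntegrableOn (fun x : Fin k → ℝ => ((Equiv.Perm.sign s : ℤ) : ℂ) * (∏ i, M (p i))
          * ∏ i, E (p (s⁻¹ i)).1 (x i) * E (p i).2 (x i))
          (Set.univ.pi fun _ : Fin k => Set.Ioi (0 : ℝ)) := fun s p => by
      refine Integrable.const_mul ?_ _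
      rw [volume_pi, Measure.restrict_pi_pi]
      exact Integrable.fintype_prod (f := fun i x => E (p (s⁻¹ i)).1 x * E (p i).2 x)
        fun i => hE _ _
    rw [integral_finsetSum _ fun s _ => integrable_finsetSum _ fun p _ => hint s p]
    refine Finset.sum_congr rfl fun s _ => ?_
    rw [integral_finsetSum _ fun p _ => hint s p]
    refine Finset.sum_congr rfl fun p _ => ?_
    rw [integral_const_mul]
    ring
  · intro k hk
    have hk' : N < k := by simpa [Nat.lt_succ_iff] using hk
    simp only [det_separableKernel_eq_zero E M hk', integral_zero, mul_zero]

end Separable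

/-- `d/dt Q(e^{-ct}, e^{-t})` is again a polynomial in `e^{-ct}` and `e^{-t}`. -/
theorem exists_hasDerivAt_eval_exp (c : ℂ) (Q : MvPolynomial (Fin 2) ℂ) :
    ∃ P : MvPolynomial (Fin 2) ℂ, ∀ t : ℂ,
      HasDerivAt (fun t => MvPolynomial.eval ![Complex.exp (-(c * t)), Complex.exp (-t)] Q)
        (MvPolynomial.eval ![Complex.exp (-(c * t)), Complex.exp (-t)] P) t := by
  induction Q using MvPolynomial.induction_on with
  | C a => exact ⟨0, fun t => by simpa using hasDerivAt_const t a⟩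
  | add p q hp hq =>
    obtain ⟨p', hp'⟩ := hp
    obtain ⟨q', hq'⟩ := hq
    exact ⟨p' + q', fun t => by
      simpa only [map_add] using (hp' t).fun_add (hq' t)⟩
  | mul_X p i hp =>
    obtain ⟨p', hp'⟩ := hp
    have hX : ∃ x : MvPolynomial (Fin 2) ℂ, ∀ t : ℂ,
        HasDerivAt (fun t => (![Complex.exp (-(c * t)), Complex.exp (-t)] : Fin 2 → ℂ) i)
          (MvPolynomial.eval ![Complex.exp (-(c * t)), Complex.exp (-t)] x) t := by
      fin_cases i
      · refine ⟨MvPolynomial.C (-c) * MvPolynomial.X 0, fun t => ?_⟩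
        have := ((hasDerivAt_id t).const_mul c).neg.cexp
        simpa [mul_comm] using this
      · refine ⟨-MvPolynomial.X 1, fun t => ?_⟩
        have := (hasDerivAt_id t).neg.cexp
        simpa using this
    obtain ⟨x, hx⟩ := hX
    exact ⟨p' * MvPolynomial.X i + p * x, fun t => by
      simpa only [map_add, map_mul, MvPolynomial.eval_X] using (hp' t).fun_mul (hx t)⟩

end TauSystem

/-! ### Real polynomials: logarithms of factorisations and reality of coefficients -/

/-- A nonzero real polynomial is, up to a constant, a product of linear factors and of quadratic
factors without real zeros; taking logarithms turns the product into a sum. -/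
theorem Polynomial.exists_log_abs_eval_eq_sum (p : Polynomial ℝ) (hp : p ≠ 0) :
    ∃ (m m' : ℕ) (C : ℝ) (a : Fin m → ℝ) (b c : Fin m' → ℝ), (∀ j, b j ^ 2 < c j) ∧
      ∀ z : ℝ, p.eval z ≠ 0 → (∀ k, z ≠ a k) ∧ Real.log |p.eval z|
        = C + (∑ k, Real.log |z - a k|) + ∑ j, Real.log (z ^ 2 + 2 * b j * z + c j) := by
  induction p using WfDvdMonoid.induction_on_irreducible with
  | zero => exact absurd rfl hp
  | unit u hu =>
    obtain ⟨r, _, rfl⟩ := Polynomial.isUnit_iff.1 hu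
    exact ⟨0, 0, Real.log |r|, ![], ![], ![], fun j => j.elim0, fun z _ =>
      ⟨fun k => k.elim0, by simp⟩⟩
  | mul g i hg hi ih =>
    obtain ⟨m, m', C, a, b, c, hbc, h⟩ := ih hg
    have hle : i.natDegree ≤ 2 := Polynomial.natDegree_le_of_degree_le hi.degree_le_two
    have hpos : 0 < i.natDegree := hi.natDegree_pos
    have hlead : i.coeff i.natDegree ≠ 0 := by
      rw [Polynomial.coeff_natDegree, Ne, Polynomial.leadingCoeff_eq_zero]
      exact hi.ne_zero
    obtain h1 | h2 : i.natDegree = 1 ∨ i.natDegree = 2 := by omega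
    · rw [h1] at hlead
      have hev : ∀ z, i.eval z = i.coeff 1 * (z - -(i.coeff 0 / i.coeff 1)) := fun z => by
        rw [Polynomial.eval_eq_sum_range, h1, Finset.sum_range_succ, Finset.sum_range_one]
        field_simp
        ring
      refine ⟨m + 1, m', C + Real.log |i.coeff 1|, Fin.cons (-(i.coeff 0 / i.coeff 1)) a, b, c, hbc,
        fun z hz => ?_⟩
      rw [Polynomial.eval_mul] at hz ⊢
      obtain ⟨hk, hlog⟩ := h z (right_ne_zero_of_mul hz)
      have hz' := left_ne_zero_of_mul hz
      rw [hev] at hz'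
      refine ⟨fun k => Fin.cases (sub_ne_zero.1 (right_ne_zero_of_mul hz')) hk k, ?_⟩
      · rw [Fin.sum_univ_succ, Fin.cons_zero, abs_mul, hev, abs_mul,
          Real.log_mul (by rw [← abs_mul]; exact abs_ne_zero.2 hz')
            (abs_ne_zero.2 (right_ne_zero_of_mul hz)),
          Real.log_mul (abs_ne_zero.2 hlead) (abs_ne_zero.2 (right_ne_zero_of_mul hz')), hlog]
        simp only [Fin.cons_succ]
        ring
    · rw [h2] at hlead
      set β := i.coeff 1 / (2 * i.coeff 2) with hβ
      set γ := i.coeff 0 / i.coeff 2 with hγ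
      have hev : ∀ z, i.eval z = i.coeff 2 * (z ^ 2 + 2 * β * z + γ) := fun z => by
        rw [Polynomial.eval_eq_sum_range, h2, Finset.sum_range_succ, Finset.sum_range_succ,
          Finset.sum_range_one, hβ, hγ]
        field_simp
        ring
      -- A nonnegative discriminant would give a real root, forcing the irreducible factor to have
      -- degree 1.
      have hlt : β ^ 2 < γ := by
        by_contra hcon
        have hroot : i.IsRoot (-β + Real.sqrt (β ^ 2 - γ)) := by
          rw [Polynomial.IsRoot, hev]
          have := Real.sq_sqrt (sub_nonneg.2 (not_lt.1 hcon))
          refine mul_eq_zero_of_right _ ?_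
          linear_combination this
        have h3 : i.natDegree = 1 := Polynomial.natDegree_eq_of_degree_eq_some
          (Polynomial.degree_eq_one_of_irreducible_of_root hi hroot)
        omega
      have hquad : ∀ z, 0 < z ^ 2 + 2 * β * z + γ := fun z => by nlinarith [sq_nonneg (z + β)]
      refine ⟨m, m' + 1, C + Real.log |i.coeff 2|, a, Fin.cons β b, Fin.cons γ c,
        Fin.cases hlt hbc, fun z hz => ?_⟩
      rw [Polynomial.eval_mul] at hz ⊢
      obtain ⟨hk, hlog⟩ := h z (right_ne_zero_of_mul hz)
      refine ⟨hk, ?_⟩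
      rw [Fin.sum_univ_succ, Fin.cons_zero, Fin.cons_zero, abs_mul, hev, abs_mul,
        abs_of_pos (hquad z),
        Real.log_mul (mul_ne_zero (abs_ne_zero.2 hlead) (hquad z).ne')
          (abs_ne_zero.2 (right_ne_zero_of_mul hz)),
        Real.log_mul (abs_ne_zero.2 hlead) (hquad z).ne', hlog]
      simp only [Fin.cons_succ]
      ring

/-- A complex polynomial with real values on a real interval has real coefficients. -/
theorem Polynomial.exists_map_ofReal_eq_of_im_eval_eq_zero (p : Polynomial ℂ)
    (h : ∀ z ∈ Set.Ioo (0 : ℝ) 1, (p.eval (z : ℂ)).im = 0) :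
    ∃ q : Polynomial ℝ, q.map Complex.ofRealHom = p := by
  rw [← Polynomial.mem_lifts, Polynomial.lifts_iff_coeff_lifts]
  -- Conjugating the coefficients leaves the values on `(0, 1)` unchanged, and agreement at
  -- infinitely many points identifies the polynomials.
  have hp : p.map (starRingEnd ℂ) = p := by
    refine Polynomial.eq_of_infinite_eval_eq _ _
      (Set.Infinite.mono ?_ ((Set.Ioo_infinite (zero_lt_one' ℝ)).image
        Complex.ofReal_injective.injOn))
    rintro _ ⟨z, hz, rfl⟩
    have h1 := Polynomial.eval_map_apply (p := p) (starRingEnd ℂ) (z : ℂ)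
    rw [Complex.conj_ofReal] at h1
    exact h1.trans (Complex.conj_eq_iff_im.2 (h z hz))
  intro k
  have hk := congrArg (fun f => Polynomial.coeff f k) hp
  simp only [Polynomial.coeff_map] at hk
  exact ⟨_, Complex.conj_eq_iff_re.1 hk⟩

/-! ### Reality for Hermitian `σ`, and periodicity for rational `κ` -/

namespace TauSystem

variable {d : ℕ}

/-- If `σ` is Hermitian, the kernel is Hermitian for real values of the parameter. -/
theorem conj_hankelKernel {σ : Matrix (Fin d) (Fin d) ℂ} (hσ : σ.IsHermitian)
    (φ : ℂ → EuclideanSpace ℂ (Fin d)) (s x y : ℝ) :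
    (starRingEnd ℂ) (hankelKernel σ φ s x y) = hankelKernel σ φ s y x := by
  rw [hankelKernel, ← integral_conj, hankelKernel]
  congr 1
  funext u
  rw [inner_conj_symm, Matrix.isSymmetric_toEuclideanLin_iff.2 hσ, Complex.conj_ofReal,
    add_comm (u : ℂ), add_comm (x : ℂ)]

/-- Conjugation transposes each matrix of kernel values and so preserves its determinant; every term
of Fredholm's series is therefore real. -/
theorem tau_im_eq_zero {σ : Matrix (Fin d) (Fin d) ℂ} (hσ : σ.IsHermitian)
    (φ : ℂ → EuclideanSpace ℂ (Fin d)) (s : ℝ) : (tau σ φ s).im = 0 := by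
  rw [← Complex.conj_eq_iff_im, tau, fredholmDet, Complex.conj_tsum]
  congr 1
  funext n
  rw [map_mul, ← integral_conj]
  congr 1
  · simp
  · congr 1
    funext x
    rw [RingHom.map_det, ← Matrix.det_transpose]
    congr 1
    ext i j
    simp [conj_hankelKernel hσ]

/-- If `κ + 1/2 = a / N`, then `τ` has period `4 π i N`. -/
theorem tau_add_period {κ : ℝ} {a N : ℕ} (h : (κ + 1 / 2) * N = a)
    (σ : Matrix (Fin d) (Fin d) ℂ) (χ : ℕ → EuclideanSpace ℂ (Fin d)) (w : ℂ) :
    tau σ (symbol κ χ) (w + 4 * Real.pi * Complex.I * N) = tau σ (symbol κ χ) w := by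
  have hper : ∀ t : ℂ, symbol κ χ (t + 4 * Real.pi * Complex.I * N) = symbol κ χ t := fun t => by
    unfold symbol
    congr 1
    funext l
    congr 1
    -- The shift changes the exponent by `-(κ + l + 1/2) · 4πiN = -2(a + lN) · 2πi`.
    refine Complex.exp_eq_exp_iff_exists_int.2 ⟨-(2 * (a + l * N : ℕ)), ?_⟩
    have h' : ((κ : ℂ) + 1 / 2) * N = a := by
      have := congrArg Complex.ofReal h
      push_cast at this
      exact this
    push_cast
    linear_combination (-4 * Real.pi * Complex.I) * h'
  have hper' : ∀ t : ℂ, symbol κ χ (t - 4 * Real.pi * Complex.I * N) = symbol κ χ t := fun t => by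
    rw [← hper (t - _), sub_add_cancel]
  unfold tau
  congr 1
  funext x y
  unfold hankelKernel
  congr 1
  funext u
  -- In the first slot `conj w` moves by the negative of the period, so the inverse shift is needed
  -- there.
  rw [← add_assoc, hper, ← hper' (_ + (starRingEnd ℂ) w)]
  congr 2
  simp only [map_add, map_mul, Complex.conj_I, Complex.conj_ofReal, map_ofNat, map_natCast]
  ring


/-! ### Truncated tau functions as exponential polynomials, and the limit -/

theorem isOpen_rightHalfPlane : IsOpen rightHalfPlane :=
  isOpen_lt continuous_const Complex.continuous_re

theorem re_two_mul_nonneg {t : ℂ} (ht : t ∈ rightHalfPlane) : 0 ≤ (2 * t).re := by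
  have : 0 < t.re := ht
  simpa using this.le

/-- The truncated tau functions are polynomials in `e^{-(κ + 1/2) t}` and `e^{-t}`. -/
theorem exists_tauTrunc_eq_eval {κ : ℝ} (hκ : 0 < κ) (χ : ℕ → EuclideanSpace ℂ (Fin d))
    (σ : Matrix (Fin d) (Fin d) ℂ) (n : ℕ) :
    ∃ Q : MvPolynomial (Fin 2) ℂ, ∀ t : ℂ, tauTrunc κ χ σ n (2 * t)
      = MvPolynomial.eval ![Complex.exp (-(((κ + 1 / 2 : ℝ) : ℂ) * t)), Complex.exp (-t)] Q := by
  let E : Fin (n + 1) → ℝ → ℂ := fun l x => Complex.exp (-((κ + l + 1 / 2 : ℝ) : ℂ) * x)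
  have hE : ∀ l m, IntegrableOn (fun x => E l x * E m x) (Set.Ioi 0) := fun l m => by
    have hlm : (-((κ + l + 1 / 2 : ℝ) : ℂ) + -((κ + m + 1 / 2 : ℝ) : ℂ)).re < 0 := by
      rw [Complex.add_re, Complex.neg_re, Complex.neg_re, Complex.ofReal_re, Complex.ofReal_re,
        ← neg_add, neg_lt_zero]
      positivity
    refine (integrableOn_exp_mul_complex_Ioi hlm 0).congr (ae_of_all _ fun x => ?_)
    simp only [E]
    rw [← Complex.exp_add, add_mul]
  obtain ⟨P, hP⟩ := exists_fredholmDet_separableKernel E hE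
  let S : Fin (n + 1) × Fin (n + 1) → ℂ := fun p =>
    inner ℂ (χ p.1) (Matrix.toEuclideanLin σ (χ p.2))
      / (((κ + p.1 + 1 / 2 : ℝ) : ℂ) + ((κ + p.2 + 1 / 2 : ℝ) : ℂ))
  -- The exponents come from `((κ+l+1/2) + (κ+m+1/2)) · 2t = 4(κ+1/2)t + 2(l+m)t`.
  refine ⟨MvPolynomial.bind₁ (fun p => MvPolynomial.C (S p) * (MvPolynomial.X 0 ^ 4
    * MvPolynomial.X 1 ^ (2 * ((p.1 : ℕ) + (p.2 : ℕ))))) P, fun t => ?_⟩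
  have hK : hankelKernel σ (symbol κ (cutoff χ n)) (2 * t) = separableKernel E (fun p => S p
      * Complex.exp (-(((κ + p.1 + 1 / 2 : ℝ) : ℂ) + ((κ + p.2 + 1 / 2 : ℝ) : ℂ)) * (2 * t))) := by
    funext x y
    exact hankelKernel_cutoff hκ σ χ n (2 * t) x y
  rw [tauTrunc_eq_tau_cutoff, tau, hK, hP]
  refine Eq.trans ?_ (MvPolynomial.eval₂Hom_bind₁ (RingHom.id ℂ) _ _ P).symm
  change _ = MvPolynomial.eval _ P
  congr 2
  funext p
  simp only [MvPolynomial.coe_eval₂Hom, MvPolynomial.eval₂_mul, MvPolynomial.eval₂_C,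
    RingHom.id_apply, MvPolynomial.eval₂_pow, MvPolynomial.eval₂_X, Matrix.cons_val_zero,
    Matrix.cons_val_one, ← Complex.exp_nat_mul, ← Complex.exp_add]
  congr 2
  push_cast
  ring

/-- Locally uniform convergence becomes a limit along the product of `atTop` with the neighbourhoods
of `t`: there τ and τ_n tend to the same value τ(2t), by joint continuity in coefficients and
argument. -/
theorem tendstoLocallyUniformlyOn_tauTrunc {κ : ℝ} (hκ : 0 < κ)
    {χ : ℕ → EuclideanSpace ℂ (Fin d)} (hχ : Summable fun l => ‖χ l‖)
    (σ : Matrix (Fin d) (Fin d) ℂ) :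
    TendstoLocallyUniformlyOn (fun n t => tauTrunc κ χ σ n (2 * t))
      (fun t => tau σ (symbol κ χ) (2 * t)) atTop rightHalfPlane := by
  rw [tendstoLocallyUniformlyOn_iff_filter]
  intro t ht
  rw [tendstoUniformlyOnFilter_iff_tendsto]
  have hre : ∀ᶠ q : ℕ × ℂ in atTop ×ˢ 𝓝[rightHalfPlane] t, 0 ≤ (2 * q.2).re := by
    filter_upwards [tendsto_snd.eventually (eventually_mem_nhdsWithin (a := t))] with q hq
    exact re_two_mul_nonneg hq
  have hw : Tendsto (fun q : ℕ × ℂ => 2 * q.2) (atTop ×ˢ 𝓝[rightHalfPlane] t) (𝓝 (2 * t)) :=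
    (tendsto_snd.mono_right nhdsWithin_le_nhds).const_mul 2
  have h1 := tendsto_tau hκ σ hχ (χ := fun _ : ℕ × ℂ => χ) (χ₀ := χ) (fun _ _ => le_rfl)
    (fun _ => tendsto_const_nhds) hre hw
  have h2 := tendsto_tau hκ σ hχ (χ := fun q : ℕ × ℂ => cutoff χ q.1) (χ₀ := χ)
    (fun q l => norm_cutoff_le χ q.1 l) (fun l => (tendsto_cutoff χ l).comp tendsto_fst) hre hw
  simp only [tauTrunc_eq_tau_cutoff]
  exact (h1.prodMk_nhds h2).mono_right (nhds_le_uniformity _)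

theorem analyticNonzero_tauTrunc {κ : ℝ} (hκ : 0 < κ) {χ : ℕ → EuclideanSpace ℂ (Fin d)}
    (hχ : Summable fun l => ‖χ l‖) (σ : Matrix (Fin d) (Fin d) ℂ) (n : ℕ) :
    AnalyticNonzero fun t => tauTrunc κ χ σ n (2 * t) := by
  constructor
  · obtain ⟨Q, hQ⟩ := exists_tauTrunc_eq_eval hκ χ σ n
    obtain ⟨P, hP⟩ := exists_hasDerivAt_eval_exp ((κ + 1 / 2 : ℝ) : ℂ) Q
    simp only [hQ]
    exact fun t _ => (hP t).differentiableAt.differentiableWithinAt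
  · obtain ⟨s, hs, h⟩ := exists_tau_ne_zero hκ σ (summable_norm_cutoff hχ n)
    exact ⟨s, by simpa [rightHalfPlane] using hs, by rwa [tauTrunc_eq_tau_cutoff]⟩

theorem analyticNonzero_tau {κ : ℝ} (hκ : 0 < κ) {χ : ℕ → EuclideanSpace ℂ (Fin d)}
    (hχ : Summable fun l => ‖χ l‖) (σ : Matrix (Fin d) (Fin d) ℂ) :
    AnalyticNonzero fun t => tau σ (symbol κ χ) (2 * t) := by
  constructor
  -- Weierstrass: a locally uniform limit of holomorphic functions is holomorphic.
  · exact (tendstoLocallyUniformlyOn_tauTrunc hκ hχ σ).differentiableOn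
      (Eventually.of_forall fun n => (analyticNonzero_tauTrunc hκ hχ σ n).1) isOpen_rightHalfPlane
  · obtain ⟨s, hs, h⟩ := exists_tau_ne_zero hκ σ hχ
    exact ⟨s, by simpa [rightHalfPlane] using hs, h⟩

theorem memRationalField_logDeriv_tauTrunc {κ : ℝ} (hκ : 0 < κ)
    {χ : ℕ → EuclideanSpace ℂ (Fin d)} (hχ : Summable fun l => ‖χ l‖)
    (σ : Matrix (Fin d) (Fin d) ℂ) (n : ℕ) :
    MemRationalField (fun t => Complex.exp (-(((κ + 1 / 2 : ℝ) : ℂ) * t)))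
      (fun t => Complex.exp (-t)) (logDeriv fun t => tauTrunc κ χ σ n (2 * t)) := by
  obtain ⟨Q, hQ⟩ := exists_tauTrunc_eq_eval hκ χ σ n
  obtain ⟨P, hP⟩ := exists_hasDerivAt_eval_exp ((κ + 1 / 2 : ℝ) : ℂ) Q
  obtain ⟨t, ht, hne⟩ := (analyticNonzero_tauTrunc hκ hχ σ n).2
  simp only [hQ] at hne ⊢
  exact ⟨P, Q, ⟨t, ht, hne⟩, fun t _ _ => by rw [logDeriv_apply, (hP t).deriv]⟩

/-- If `κ + 1/2 = a / N`, the truncated tau functions are polynomials in `e^{-t/N}`. -/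
theorem exists_tauTrunc_eq_polynomial_eval {κ : ℝ} (hκ : 0 < κ) {a N : ℕ} (hN : 0 < N)
    (h : (κ + 1 / 2) * N = a) (χ : ℕ → EuclideanSpace ℂ (Fin d)) (σ : Matrix (Fin d) (Fin d) ℂ)
    (n : ℕ) :
    ∃ p : Polynomial ℂ, ∀ t : ℂ, tauTrunc κ χ σ n (2 * t) = p.eval (Complex.exp (-t / N)) := by
  obtain ⟨Q, hQ⟩ := exists_tauTrunc_eq_eval hκ χ σ n
  -- With `z = e^{-t/N}`, one has `e^{-(κ+1/2)t} = z^a` and `e^{-t} = z^N`.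
  refine ⟨MvPolynomial.aeval ![Polynomial.X ^ a, Polynomial.X ^ N] Q, fun t => ?_⟩
  have hN' : (N : ℂ) ≠ 0 := by exact_mod_cast hN.ne'
  have h' : ((κ + 1 / 2 : ℝ) : ℂ) * N = a := by exact_mod_cast h
  have h1 := MvPolynomial.comp_aeval_apply ![Polynomial.X ^ a, Polynomial.X ^ N]
    (Polynomial.aeval (R := ℂ) (Complex.exp (-t / N))) Q
  rw [Polynomial.coe_aeval_eq_eval] at h1
  rw [hQ, h1, MvPolynomial.aeval_eq_eval]
  congr 2
  funext i
  fin_cases i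
  · simp only [Fin.zero_eta, Matrix.cons_val_zero, Polynomial.eval_pow, Polynomial.eval_X,
      ← Complex.exp_nat_mul]
    congr 1
    rw [← h']
    field_simp
  · change Complex.exp (-t) = Polynomial.eval _ (Polynomial.X ^ N)
    rw [Polynomial.eval_pow, Polynomial.eval_X, ← Complex.exp_nat_mul]
    congr 1
    field_simp

theorem hasDerivAt_polynomial_eval_exp (p : Polynomial ℂ) (N : ℕ) (t : ℂ) :
    HasDerivAt (fun t => p.eval (Complex.exp (-t / N)))
      ((Polynomial.C (-1 / (N : ℂ)) * Polynomial.X * Polynomial.derivative p).eval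
        (Complex.exp (-t / N))) t := by
  have h1 : HasDerivAt (fun t : ℂ => Complex.exp (-t / N))
      (Complex.exp (-t / N) * (-1 / N)) t := ((hasDerivAt_id t).neg.div_const (N : ℂ)).cexp
  have h2 := (p.hasDerivAt (Complex.exp (-t / N))).comp t h1
  refine h2.congr_deriv ?_
  simp only [Polynomial.eval_mul, Polynomial.eval_C, Polynomial.eval_X]
  ring

theorem tauTrunc_im_eq_zero {σ : Matrix (Fin d) (Fin d) ℂ} (hσ : σ.IsHermitian) (κ : ℝ)
    (χ : ℕ → EuclideanSpace ℂ (Fin d)) (n : ℕ) (t : ℝ) :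
    (tauTrunc κ χ σ n (2 * (t : ℂ))).im = 0 := by
  have := tau_im_eq_zero hσ (realisedSymbol (truncA κ n) (truncB χ n) (truncC χ n)) (2 * t)
  rw [tauTrunc]
  simpa using this

theorem exists_log_abs_tauTrunc_eq {κ : ℝ} (hκ : 0 < κ) {χ : ℕ → EuclideanSpace ℂ (Fin d)}
    (hχ : Summable fun l => ‖χ l‖) {σ : Matrix (Fin d) (Fin d) ℂ} (hσ : σ.IsHermitian) (n : ℕ)
    {N : ℕ} (hN : 0 < N) {p : Polynomial ℂ}
    (hp : ∀ t : ℂ, tauTrunc κ χ σ n (2 * t) = p.eval (Complex.exp (-t / N))) :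
    ∃ (m m' : ℕ) (q : Polynomial ℝ) (α a : Fin m → ℝ) (β γ b c : Fin m' → ℝ),
      (∀ j, b j ^ 2 < c j) ∧
      ∀ t : ℝ, 0 < t → tauTrunc κ χ σ n (2 * (t : ℂ)) ≠ 0 →
        (∀ k, Real.exp (-t / N) ≠ a k) ∧
        Real.log |(tauTrunc κ χ σ n (2 * (t : ℂ))).re|
          = elementaryForm q α a β γ b c (Real.exp (-t / N)) := by
  have hN' : (N : ℝ) ≠ 0 := by exact_mod_cast hN.ne'
  obtain ⟨r, rfl⟩ := p.exists_map_ofReal_eq_of_im_eval_eq_zero fun z hz => by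
    -- The point `t = -N log z` solves `e^{-t/N} = z`.
    have h := tauTrunc_im_eq_zero hσ κ χ n (-(N * Real.log z))
    rw [hp, Complex.ofReal_neg, neg_neg, Complex.ofReal_mul, Complex.ofReal_natCast,
      mul_div_cancel_left₀ _ (by exact_mod_cast hN'), ← Complex.ofReal_exp,
      Real.exp_log hz.1] at h
    exact h
  have hr : ∀ t : ℝ, tauTrunc κ χ σ n (2 * (t : ℂ)) = (r.eval (Real.exp (-t / N)) : ℝ) :=
    fun t => by
      rw [hp]
      refine Eq.trans ?_ (Polynomial.eval_map_apply (p := r) Complex.ofRealHom (Real.exp (-t / N)))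
      congr 1
      rw [Complex.ofRealHom_eq_coe, Complex.ofReal_exp]
      push_cast
      rfl
  have hr0 : r ≠ 0 := by
    rintro rfl
    obtain ⟨t, _, ht⟩ := (analyticNonzero_tauTrunc hκ hχ σ n).2
    exact ht (by simp [hp])
  obtain ⟨m, m', C, a, b, c, hbc, h⟩ := r.exists_log_abs_eval_eq_sum hr0
  -- Factors are listed with repetition, so all logarithms have coefficient 1; the polynomial part
  -- is the constant `C` and no arctangent is needed.
  refine ⟨m, m', Polynomial.C C, fun _ => 1, a, fun _ => 1, fun _ => 0, b, c, hbc,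
    fun t _ hne => ?_⟩
  rw [hr] at hne ⊢
  obtain ⟨h1, h2⟩ := h _ (Complex.ofReal_ne_zero.1 hne)
  refine ⟨h1, ?_⟩
  rw [Complex.ofReal_re, h2]
  simp [elementaryForm]

end TauSystem

theorem theorem10p2 (d : ℕ) (κ : ℝ) (hκ : 0 < κ) (χ : ℕ → EuclideanSpace ℂ (Fin d))
    (hχ : Summable fun l => ‖χ l‖) (σ : Matrix (Fin d) (Fin d) ℂ) :
    -- `τ(2t)` is analytic and not identically zero
    TauSystem.AnalyticNonzero (fun t => TauSystem.tau σ (TauSystem.symbol κ χ) (2 * t)) ∧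
    -- (i)
    (∀ n : ℕ,
      FiniteDimensional ℂ (TauSystem.truncA κ n).range ∧
      TauSystem.AnalyticNonzero (fun t => TauSystem.tauTrunc κ χ σ n (2 * t)) ∧
      TauSystem.MemRationalField
        (fun t => Complex.exp (-(((κ + 1 / 2 : ℝ) : ℂ) * t))) (fun t => Complex.exp (-t))
        (logDeriv fun t => TauSystem.tauTrunc κ χ σ n (2 * t))) ∧
    (∀ S : Set ℂ, IsCompact S → S ⊆ TauSystem.rightHalfPlane →
      TendstoUniformlyOn (fun n t => TauSystem.tauTrunc κ χ σ n (2 * t))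
        (fun t => TauSystem.tau σ (TauSystem.symbol κ χ) (2 * t)) atTop S) ∧
    -- (ii)
    ((∃ r : ℚ, (r : ℝ) = κ) →
      ∃ N : ℕ, 0 < N ∧
        (∀ t ∈ TauSystem.rightHalfPlane,
          logDeriv (fun s => TauSystem.tau σ (TauSystem.symbol κ χ) (2 * s))
              (t + 2 * Real.pi * Complex.I * N)
            = logDeriv (fun s => TauSystem.tau σ (TauSystem.symbol κ χ) (2 * s)) t) ∧
        (∀ n : ℕ, ∃ p q : Polynomial ℂ, q ≠ 0 ∧
          ∀ t ∈ TauSystem.rightHalfPlane, q.eval (Complex.exp (-t / N)) ≠ 0 →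
            logDeriv (fun s => TauSystem.tauTrunc κ χ σ n (2 * s)) t
              = p.eval (Complex.exp (-t / N)) / q.eval (Complex.exp (-t / N))) ∧
        (σ.IsHermitian → ∀ n : ℕ,
          (∀ t : ℝ, 0 < t → (TauSystem.tauTrunc κ χ σ n (2 * (t : ℂ))).im = 0) ∧
          ∃ (m m' : ℕ) (q : Polynomial ℝ) (α a : Fin m → ℝ) (β γ b c : Fin m' → ℝ),
            (∀ j, b j ^ 2 < c j) ∧
            ∀ t : ℝ, 0 < t → TauSystem.tauTrunc κ χ σ n (2 * (t : ℂ)) ≠ 0 →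
              (∀ k, Real.exp (-t / N) ≠ a k) ∧
              Real.log |(TauSystem.tauTrunc κ χ σ n (2 * (t : ℂ))).re|
                = TauSystem.elementaryForm q α a β γ b c (Real.exp (-t / N)))) := by
  refine ⟨TauSystem.analyticNonzero_tau hκ hχ σ, fun n =>
    ⟨TauSystem.finiteDimensional_range_truncA κ n, TauSystem.analyticNonzero_tauTrunc hκ hχ σ n,
      TauSystem.memRationalField_logDeriv_tauTrunc hκ hχ σ n⟩, fun S hS hsub => ?_, ?_⟩
  · exact (tendstoLocallyUniformlyOn_iff_forall_isCompact TauSystem.isOpen_rightHalfPlane).1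
      (TauSystem.tendstoLocallyUniformlyOn_tauTrunc hκ hχ σ) S hsub hS
  rintro ⟨r, rfl⟩
  -- `N` is the denominator of `κ + 1/2` in lowest terms and `a` its numerator, which is nonnegative
  -- and so is a natural number.
  set s : ℚ := r + 1 / 2 with hs
  have hs0 : 0 ≤ s := by
    have : (0 : ℚ) < r := by exact_mod_cast hκ
    positivity
  have hN : 0 < s.den := s.pos
  have h : ((r : ℝ) + 1 / 2) * (s.den : ℕ) = (s.num.toNat : ℕ) := by
    have h1 : (s.num.toNat : ℤ) = s.num := Int.toNat_of_nonneg (Rat.num_nonneg.2 hs0)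
    have h2 : s * s.den = (s.num.toNat : ℚ) := by
      rw [Rat.mul_den_eq_num]
      exact_mod_cast h1.symm
    have h3 : ((s * s.den : ℚ) : ℝ) = ((s.num.toNat : ℚ) : ℝ) := congrArg _ h2
    have h4 : (s : ℝ) = (r : ℝ) + 1 / 2 := by rw [hs]; push_cast; rfl
    rw [Rat.cast_mul, h4, Rat.cast_natCast, Rat.cast_natCast] at h3
    exact h3
  refine ⟨s.den, hN, fun t _ => ?_, fun n => ?_, fun hσ n => ⟨fun t _ =>
    TauSystem.tauTrunc_im_eq_zero hσ _ χ n t, ?_⟩⟩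
  -- Doubling turns the shift `2πiN` of `t` into the period `4πiN` of τ; the derivative inherits the
  -- period.
  · have hper : (fun z => TauSystem.tau σ (TauSystem.symbol r χ)
        (2 * (z + 2 * Real.pi * Complex.I * s.den)))
        = fun z => TauSystem.tau σ (TauSystem.symbol r χ) (2 * z) := by
      funext z
      rw [← TauSystem.tau_add_period h σ χ (2 * z)]
      congr 1
      ring
    rw [logDeriv_apply, logDeriv_apply, ← deriv_comp_add_const, hper]
    exact congrArg _ (congrFun hper t)
  · obtain ⟨p, hp⟩ := TauSystem.exists_tauTrunc_eq_polynomial_eval hκ hN h χ σ n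
    refine ⟨Polynomial.C (-1 / (s.den : ℂ)) * Polynomial.X * Polynomial.derivative p, p, ?_,
      fun t _ _ => ?_⟩
    · rintro rfl
      obtain ⟨t, _, ht⟩ := (TauSystem.analyticNonzero_tauTrunc hκ hχ σ n).2
      exact ht (by simp [hp])
    · rw [logDeriv_apply, funext hp, (TauSystem.hasDerivAt_polynomial_eval_exp p s.den t).deriv,
        hp]
  · obtain ⟨p, hp⟩ := TauSystem.exists_tauTrunc_eq_polynomial_eval hκ hN h χ σ n
    exact TauSystem.exists_log_abs_tauTrunc_eq hκ hχ hσ n hN hp
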